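/- Let $\gamma$ range over the set of positive imaginary parts (ordinates) of the non-trivial zeros of the Riemann zeta function, and let $N(T)$ be the number of non-trivial zeros, counted with multiplicity, with imaginary part in $[0,T]$. Assume the Effective Linear Independence conjecture: for every $\varepsilon>0$ there is a constant $C_\varepsilon>0$ such that for all real $T\ge 2$ and all integers $\ell_\gamma$ $(0<\gamma\le T)$, not all zero, with $|\ell_\gamma|\le N(T)$, one has $$\Big|\sum_{0<\gamma\le T}\ell_\gamma\gamma\Big|\ge C_\varepsilon e^{-T^{1+\varepsilon}}.$$ Let $(r_\gamma)_{\gamma>0}$ be complex numbers indexed by the positive ordinates for which there are constants $A>0$ and $1\le\theta<3-\sqrt3$ such that, as $T\to\infty$, 1. $\sum_{0<\gamma\le T}|r_\gamma|\asymp(\log T)^A$; 2. $\sum_{0<\gamma\le T}\gamma|r_\gamma|=o\big(T(\log T)^A\big)$; 3. $\sum_{0<\gamma\le T}\gamma^2|r_\gamma|^2\ll T^\theta$. For real $Y$ and $x>0$ put $\Phi_{Y}(x)=\mathrm{Re}\sum_{0<\gamma\le Y}x^{i\gamma}r_\gamma$. Then there exist positive constants $C_1$ and $C_2$, independent of $X$,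 such that for all sufficiently large real $X$ $$\max_{x\in[2,X]}\Phi_{X^2}(x)\ge C_1(\log\log\log X)^A\quad\text{and}\quad\min_{x\in[2,X]}\Phi_{X^2}(x)\le -C_2(\log\log\log X)^A.$$ -/

import Mathlib

open Filter Asymptotics

noncomputable section

/-- The non-trivial zeros of the Riemann zeta function: those in the open critical strip. -/
def nontrivialZetaZeros : Set ℂ :=
  {ρ | riemannZeta ρ = 0 ∧ 0 < ρ.re ∧ ρ.re < 1}

theorem finite_nontrivialZetaZeros (T : ℝ) :
    {ρ | ρ ∈ nontrivialZetaZeros ∧ 0 ≤ ρ.im ∧ ρ.im ≤ T}.Finite := by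
  have hK : IsCompact (Set.Icc (0 : ℝ) 1 ×ℂ Set.Icc (0 : ℝ) T) :=
    isCompact_Icc.reProdIm isCompact_Icc
  refine hK.inter_riemannZetaZeros_finite.subset ?_
  rintro ρ ⟨⟨h0, h1, h2⟩, h3, h4⟩
  exact ⟨⟨⟨h1.le, h2.le⟩, ⟨h3, h4⟩⟩, h0⟩

/-- `zetaZeroCount T` is `N(T)`, the number of non-trivial zeros with imaginary part in `[0, T]`,
counted with multiplicity. -/
def zetaZeroCount (T : ℝ) : ℕ :=
  ∑ ρ ∈ (finite_nontrivialZetaZeros T).toFinset, analyticOrderNatAt riemannZeta ρ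

theorem finite_ordinates (T : ℝ) :
    {γ : ℝ | 0 < γ ∧ γ ≤ T ∧ ∃ ρ ∈ nontrivialZetaZeros, ρ.im = γ}.Finite := by
  refine ((finite_nontrivialZetaZeros T).image Complex.im).subset ?_
  rintro γ ⟨h0, h1, ρ, hρ, rfl⟩
  exact ⟨ρ, ⟨hρ, h0.le, h1⟩, rfl⟩

/-- The finite set of the ordinates `γ` of non-trivial zeros with `0 < γ ≤ T`. -/
def zetaOrdinates (T : ℝ) : Finset ℝ := (finite_ordinates T).toFinset

/-- The Effective Linear Independence conjecture. -/
def EffectiveLI : Prop :=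
  ∀ ε : ℝ, 0 < ε → ∃ C : ℝ, 0 < C ∧ ∀ T : ℝ, 2 ≤ T → ∀ ℓ : ℝ → ℤ,
    (∀ γ ∈ zetaOrdinates T, |ℓ γ| ≤ (zetaZeroCount T : ℤ)) →
    (∃ γ ∈ zetaOrdinates T, ℓ γ ≠ 0) →
    C * Real.exp (-T ^ (1 + ε)) ≤ |∑ γ ∈ zetaOrdinates T, (ℓ γ : ℝ) * γ|

/-- `zetaSum r Y x = Re ∑_{0 < γ ≤ Y} x^{iγ} r_γ`. -/
def zetaSum (r : ℝ → ℂ) (Y x : ℝ) : ℝ :=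
  (∑ γ ∈ zetaOrdinates Y, (x : ℂ) ^ (Complex.I * (γ : ℂ)) * r γ).re

end

/-- The Riesz product `∏_{γ ∈ S} (1 + cos (γ t - β γ))`. -/
noncomputable def rieszProduct (β : ℝ → ℝ) (S : Finset ℝ) (t : ℝ) : ℝ :=
  ∏ γ ∈ S, (1 + Real.cos (γ * t - β γ))

theorem rieszProduct_nonneg (β : ℝ → ℝ) (S : Finset ℝ) (t : ℝ) : 0 ≤ rieszProduct β S t :=
  Finset.prod_nonneg fun γ _ => by linarith [Real.neg_one_le_cos (γ * t - β γ)]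

@[fun_prop]
theorem continuous_rieszProduct (β : ℝ → ℝ) (S : Finset ℝ) : Continuous (rieszProduct β S) := by
  unfold rieszProduct
  fun_prop

/-- The Fourier coefficient of a Riesz product over `[a, b]`, without normalization. -/
noncomputable def rieszCoeff (β : ℝ → ℝ) (a b : ℝ) (S : Finset ℝ) (ω : ℝ) : ℂ :=
  ∫ t in a..b, (rieszProduct β S t : ℂ) * Complex.exp (Complex.I * ω * t)

theorem norm_integral_exp_le (a b : ℝ) {ω : ℝ} (hω : ω ≠ 0) :
    ‖∫ t in a..b, Complex.exp (Complex.I * ω * t)‖ ≤ 2 / |ω| := by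
  have hc : Complex.I * (ω : ℂ) ≠ 0 := by simp [hω]
  have key : ∀ t : ℝ, ‖Complex.exp (Complex.I * ω * t)‖ = 1 := fun t => by
    rw [Complex.norm_exp]; simp
  rw [integral_exp_mul_complex hc, norm_div, norm_mul, Complex.norm_I, one_mul,
    Complex.norm_real, Real.norm_eq_abs]
  gcongr
  refine (norm_sub_le _ _).trans ?_
  rw [key, key]
  norm_num

theorem rieszCoeff_insert (β : ℝ → ℝ) (a b : ℝ) {S : Finset ℝ} {γ : ℝ} (hγ : γ ∉ S) (ω : ℝ) :
    rieszCoeff β a b (insert γ S) ω = rieszCoeff β a b S ω +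
      Complex.exp (-(Complex.I * β γ)) / 2 * rieszCoeff β a b S (ω + γ) +
      Complex.exp (Complex.I * β γ) / 2 * rieszCoeff β a b S (ω - γ) := by
  unfold rieszCoeff
  rw [← intervalIntegral.integral_const_mul, ← intervalIntegral.integral_const_mul,
    ← intervalIntegral.integral_add, ← intervalIntegral.integral_add]
  · refine intervalIntegral.integral_congr fun t _ => ?_
    have h1 : Complex.exp (Complex.I * ((ω + γ : ℝ) : ℂ) * t) * Complex.exp (-(Complex.I * β γ)) =
        Complex.exp (Complex.I * ω * t) * Complex.exp ((γ * t - β γ) * Complex.I) := by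
      rw [← Complex.exp_add, ← Complex.exp_add]; push_cast; ring_nf
    have h2 : Complex.exp (Complex.I * ((ω - γ : ℝ) : ℂ) * t) * Complex.exp (Complex.I * β γ) =
        Complex.exp (Complex.I * ω * t) * Complex.exp (-(γ * t - β γ) * Complex.I) := by
      rw [← Complex.exp_add, ← Complex.exp_add]; push_cast; ring_nf
    simp only [rieszProduct, Finset.prod_insert hγ]
    push_cast
    rw [Complex.cos]
    push_cast at h1 h2
    linear_combination (-(1 / 2 : ℂ) * ∏ x ∈ S, (1 + Complex.cos (x * t - β x))) * (h1 + h2)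
  all_goals exact Continuous.intervalIntegrable (by fun_prop) _ _

theorem norm_exp_I_mul_half (x : ℝ) : ‖Complex.exp (Complex.I * x) / 2‖ = 1 / 2 := by
  rw [norm_div, mul_comm, Complex.norm_exp_ofReal_mul_I]; simp

theorem norm_exp_neg_I_mul_half (x : ℝ) : ‖Complex.exp (-(Complex.I * x)) / 2‖ = 1 / 2 := by
  simpa using norm_exp_I_mul_half (-x)

theorem sum_update_mul {S : Finset ℝ} {γ : ℝ} (hγ : γ ∉ S) (e : ℝ → ℤ) (k : ℤ) :
    ∑ x ∈ insert γ S, (Function.update e γ k x : ℝ) * x = k * γ + ∑ x ∈ S, (e x : ℝ) * x := by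
  rw [Finset.sum_insert hγ, Function.update_self]
  congr 1
  refine Finset.sum_congr rfl fun x hx => ?_
  rw [Function.update_of_ne (ne_of_mem_of_not_mem hx hγ)]

theorem abs_update_le {S : Finset ℝ} {γ : ℝ} {e : ℝ → ℤ} {k : ℤ} (hk : |k| ≤ 1)
    (he : ∀ x ∈ S, |e x| ≤ 1) : ∀ x ∈ insert γ S, |Function.update e γ k x| ≤ 1 := by
  intro x hx
  rcases eq_or_ne x γ with rfl | hne
  · simpa using hk
  · rw [Function.update_of_ne hne]
    exact he x ((Finset.mem_insert.1 hx).resolve_left hne)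

/-- A Riesz product is almost orthogonal to a frequency away from its spectrum. -/
theorem norm_rieszCoeff_le (β : ℝ → ℝ) (a b : ℝ) {δ : ℝ} (hδ : 0 < δ) (S : Finset ℝ) (ω : ℝ)
    (h : ∀ e : ℝ → ℤ, (∀ x ∈ S, |e x| ≤ 1) → δ ≤ |ω + ∑ x ∈ S, (e x : ℝ) * x|) :
    ‖rieszCoeff β a b S ω‖ ≤ 2 ^ S.card * (2 / δ) := by
  induction S using Finset.induction_on generalizing ω with
  | empty =>
    have h0 := h 0 (by simp)
    simp only [Finset.sum_empty, add_zero] at h0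
    have hω : ω ≠ 0 := abs_pos.1 (hδ.trans_le h0)
    simp only [rieszCoeff, rieszProduct, Finset.prod_empty, Complex.ofReal_one, one_mul,
      Finset.card_empty, pow_zero]
    exact (norm_integral_exp_le a b hω).trans (by gcongr)
  | insert γ S hγ ih =>
    have hk : ∀ k : ℤ, |k| ≤ 1 →
        ‖rieszCoeff β a b S (ω + k * γ)‖ ≤ 2 ^ S.card * (2 / δ) := fun k hk =>
      ih _ fun e he => by
        have := h (Function.update e γ k) (abs_update_le hk he)
        rwa [sum_update_mul hγ, ← add_assoc] at this
    have h0 := hk 0 (by simp)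
    have h1 := hk 1 (by simp)
    have h2 := hk (-1) (by simp)
    simp only [Int.cast_zero, zero_mul, add_zero, Int.cast_one, one_mul, Int.cast_neg, neg_mul,
      ← sub_eq_add_neg] at h0 h1 h2
    rw [rieszCoeff_insert β a b hγ, Finset.card_insert_of_notMem hγ]
    refine (norm_add₃_le).trans ?_
    rw [norm_mul, norm_mul, norm_exp_I_mul_half, norm_exp_neg_I_mul_half, pow_succ]
    linarith

/-- The mean value of a Riesz product with dissociate frequencies is almost `1`. -/
theorem norm_rieszCoeff_zero_sub_le (β : ℝ → ℝ) (a b : ℝ) {δ : ℝ} (hδ : 0 < δ) (S : Finset ℝ)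
    (h : ∀ e : ℝ → ℤ, (∀ x ∈ S, |e x| ≤ 1) → (∃ x ∈ S, e x ≠ 0) →
      δ ≤ |∑ x ∈ S, (e x : ℝ) * x|) :
    ‖rieszCoeff β a b S 0 - (b - a)‖ ≤ 2 ^ S.card * (2 / δ) := by
  induction S using Finset.induction_on with
  | empty =>
    simp only [rieszCoeff, rieszProduct, Finset.prod_empty, Complex.ofReal_one, one_mul,
      Complex.ofReal_zero, mul_zero, zero_mul, Complex.exp_zero, Finset.card_empty, pow_zero]
    simp only [intervalIntegral.integral_const, Complex.real_smul, mul_one, Complex.ofReal_sub,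
      sub_self, norm_zero]
    positivity
  | insert γ S hγ ih =>
    have h0 := ih fun e he ⟨x, hx, hxe⟩ => by
      have := h (Function.update e γ 0) (abs_update_le (by simp) he)
        ⟨x, Finset.mem_insert_of_mem hx, by
          rwa [Function.update_of_ne (ne_of_mem_of_not_mem hx hγ)]⟩
      rw [sum_update_mul hγ] at this
      simpa using this
    have hk : ∀ k : ℤ, |k| ≤ 1 → k ≠ 0 →
        ‖rieszCoeff β a b S (0 + k * γ)‖ ≤ 2 ^ S.card * (2 / δ) := fun k hk hk0 =>
      norm_rieszCoeff_le β a b hδ S _ fun e he => by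
        have := h (Function.update e γ k) (abs_update_le hk he)
          ⟨γ, Finset.mem_insert_self _ _, by simpa using hk0⟩
        rwa [sum_update_mul hγ, ← zero_add (k * γ : ℝ)] at this
    have h1 := hk 1 (by simp) (by simp)
    have h2 := hk (-1) (by simp) (by simp)
    simp only [Int.cast_one, one_mul, Int.cast_neg, neg_mul, ← sub_eq_add_neg] at h1 h2
    rw [rieszCoeff_insert β a b hγ, Finset.card_insert_of_notMem hγ, add_sub_right_comm,
      add_sub_right_comm]
    refine (norm_add₃_le).trans ?_
    rw [norm_mul, norm_mul, norm_exp_I_mul_half, norm_exp_neg_I_mul_half, pow_succ]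
    linarith

/-- The Fourier coefficient of a Riesz product at one of its own frequencies. -/
theorem norm_rieszCoeff_self_sub_le (β : ℝ → ℝ) (a b : ℝ) {δ : ℝ} (hδ : 0 < δ) (S : Finset ℝ)
    (h : ∀ e : ℝ → ℤ, (∀ x ∈ S, |e x| ≤ 2) → (∃ x ∈ S, e x ≠ 0) →
      δ ≤ |∑ x ∈ S, (e x : ℝ) * x|) {γ : ℝ} (hγS : γ ∈ S) :
    ‖rieszCoeff β a b S γ - Complex.exp (Complex.I * β γ) / 2 * (b - a)‖ ≤
      2 ^ S.card * (2 / δ) := by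
  obtain ⟨S, hγ, rfl⟩ : ∃ S', γ ∉ S' ∧ S = insert γ S' :=
    ⟨S.erase γ, Finset.notMem_erase _ _, (Finset.insert_erase hγS).symm⟩
  have hup : ∀ (e : ℝ → ℤ) (k : ℤ), |k| ≤ 2 → (∀ x ∈ S, |e x| ≤ 1) →
      ∀ x ∈ insert γ S, |Function.update e γ k x| ≤ 2 := by
    intro e k hk he x hx
    rcases eq_or_ne x γ with rfl | hne
    · simpa using hk
    · rw [Function.update_of_ne hne]
      exact (he x ((Finset.mem_insert.1 hx).resolve_left hne)).trans (by norm_num)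
  have h0 := norm_rieszCoeff_zero_sub_le β a b hδ S fun e he ⟨x, hx, hxe⟩ => by
    have := h (Function.update e γ 0) (hup e 0 (by simp) he)
      ⟨x, Finset.mem_insert_of_mem hx, by
        rwa [Function.update_of_ne (ne_of_mem_of_not_mem hx hγ)]⟩
    rw [sum_update_mul hγ] at this
    simpa using this
  have hk : ∀ k : ℤ, |k| ≤ 2 → k ≠ 0 →
      ‖rieszCoeff β a b S (k * γ)‖ ≤ 2 ^ S.card * (2 / δ) := fun k hk hk0 =>
    norm_rieszCoeff_le β a b hδ S _ fun e he => by
      have := h (Function.update e γ k) (hup e k hk he)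
        ⟨γ, Finset.mem_insert_self _ _, by simpa using hk0⟩
      rwa [sum_update_mul hγ] at this
  have h1 := hk 1 (by simp) (by simp)
  have h2 := hk 2 (by simp) (by simp)
  simp only [Int.cast_one, one_mul, Int.cast_ofNat, two_mul] at h1 h2
  have hsplit : rieszCoeff β a b (insert γ S) γ - Complex.exp (Complex.I * β γ) / 2 * (b - a) =
      rieszCoeff β a b S γ + Complex.exp (-(Complex.I * β γ)) / 2 * rieszCoeff β a b S (γ + γ) +
      Complex.exp (Complex.I * β γ) / 2 * (rieszCoeff β a b S 0 - (b - a)) := by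
    rw [rieszCoeff_insert β a b hγ, sub_self]; ring
  rw [hsplit, Finset.card_insert_of_notMem hγ]
  refine (norm_add₃_le).trans ?_
  rw [norm_mul, norm_mul, norm_exp_I_mul_half, norm_exp_neg_I_mul_half, pow_succ]
  linarith

theorem mem_zetaOrdinates {T γ : ℝ} :
    γ ∈ zetaOrdinates T ↔ 0 < γ ∧ γ ≤ T ∧ ∃ ρ ∈ nontrivialZetaZeros, ρ.im = γ := by
  simp [zetaOrdinates]

theorem zetaOrdinates_subset {T U : ℝ} (h : T ≤ U) : zetaOrdinates T ⊆ zetaOrdinates U :=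
  fun γ hγ => by
    rw [mem_zetaOrdinates] at hγ ⊢
    exact ⟨hγ.1, hγ.2.1.trans h, hγ.2.2⟩

theorem mem_zetaOrdinates_of_le {T U γ : ℝ} (hγ : γ ∈ zetaOrdinates U) (h : γ ≤ T) :
    γ ∈ zetaOrdinates T := by
  rw [mem_zetaOrdinates] at hγ ⊢
  exact ⟨hγ.1, h, hγ.2.2⟩

/-- Pigeonhole: a finite set in `[0, T]` with well-spaced subset sums has few elements. -/
theorem two_pow_card_le_of_dissociate {S : Finset ℝ} {T δ : ℝ} (hδ : 0 < δ)
    (hS : ∀ x ∈ S, 0 ≤ x ∧ x ≤ T)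
    (h : ∀ e : ℝ → ℤ, (∀ x ∈ S, |e x| ≤ 1) → (∃ x ∈ S, e x ≠ 0) →
      δ ≤ |∑ x ∈ S, (e x : ℝ) * x|) :
    (2 : ℝ) ^ S.card ≤ S.card * T / δ + 1 := by
  classical
  have hinj : Set.InjOn (fun B : Finset ℝ => ⌊(∑ x ∈ B, x) / δ⌋₊) (S.powerset : Set (Finset ℝ)) := by
    intro B hB C hC hBC
    simp only [Finset.coe_powerset, Set.mem_preimage, Set.mem_powerset_iff, Finset.coe_subset]
      at hB hC
    by_contra hne
    have hnn : ∀ B ⊆ S, 0 ≤ (∑ x ∈ B, x) / δ := fun B hB =>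
      div_nonneg (Finset.sum_nonneg fun x hx => (hS x (hB hx)).1) hδ.le
    have hind : ∀ B ⊆ S, ∑ x ∈ S, (if x ∈ B then x else 0) = ∑ x ∈ B, x := fun B hB => by
      rw [← Finset.sum_filter]
      congr 1
      ext x
      simp only [Finset.mem_filter]
      exact ⟨fun h => h.2, fun h => ⟨hB h, h⟩⟩
    have key := h (fun x => (if x ∈ B then 1 else 0) - if x ∈ C then 1 else 0)
      (fun x _ => by split_ifs <;> simp) (by
        by_contra! h0
        refine hne (Finset.ext fun x => ?_)
        by_cases hx : x ∈ S
        · have := h0 x hx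
          split_ifs at this with h1 h2 h2 <;> simp_all
        · exact ⟨fun h' => absurd (hB h') hx, fun h' => absurd (hC h') hx⟩)
    have hsum : ∑ x ∈ S, (((if x ∈ B then 1 else 0) - if x ∈ C then 1 else 0 : ℤ) : ℝ) * x =
        ∑ x ∈ B, x - ∑ x ∈ C, x := by
      rw [← hind B hB, ← hind C hC, ← Finset.sum_sub_distrib]
      refine Finset.sum_congr rfl fun x _ => ?_
      split_ifs <;> simp
    have h1 := Nat.floor_le (hnn B hB)
    have h2 := Nat.lt_floor_add_one ((∑ x ∈ B, x) / δ)
    have h3 := Nat.floor_le (hnn C hC)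
    have h4 := Nat.lt_floor_add_one ((∑ x ∈ C, x) / δ)
    simp only at hBC
    rw [hBC] at h1 h2
    have h5 : |(∑ x ∈ B, x) / δ - (∑ x ∈ C, x) / δ| < 1 := by
      rw [abs_lt]; constructor <;> linarith
    rw [hsum] at key
    rw [← sub_div, abs_div, abs_of_pos hδ, div_lt_one hδ] at h5
    linarith
  have hmaps : ∀ B ∈ S.powerset, ⌊(∑ x ∈ B, x) / δ⌋₊ ∈ Finset.range (⌊S.card * T / δ⌋₊ + 1) := by
    intro B hB
    rw [Finset.mem_range, Nat.lt_succ_iff]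
    refine Nat.floor_le_floor ?_
    gcongr
    calc ∑ x ∈ B, x ≤ ∑ x ∈ S, x :=
          Finset.sum_le_sum_of_subset_of_nonneg (Finset.mem_powerset.1 hB) fun x hx _ => (hS x hx).1
      _ ≤ S.card * T := by
          simpa using Finset.sum_le_card_nsmul S (fun x => x) T fun x hx => (hS x hx).2
  have hcard := Finset.card_le_card_of_injOn _ hmaps hinj
  rw [Finset.card_powerset, Finset.card_range] at hcard
  have hnn : 0 ≤ (S.card : ℝ) * T / δ := by
    rcases S.eq_empty_or_nonempty with rfl | ⟨x, hx⟩
    · simp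
    · have := (hS x hx).1.trans (hS x hx).2
      positivity
  calc (2 : ℝ) ^ S.card ≤ ((⌊S.card * T / δ⌋₊ + 1 : ℕ) : ℝ) := by exact_mod_cast hcard
    _ ≤ _ := by push_cast; linarith [Nat.floor_le hnn]

theorem zetaSum_exp (r : ℝ → ℂ) (Y t : ℝ) :
    zetaSum r Y (Real.exp t) =
      (∑ γ ∈ zetaOrdinates Y, r γ * Complex.exp (Complex.I * γ * t)).re := by
  unfold zetaSum
  congr 1
  refine Finset.sum_congr rfl fun γ _ => ?_
  rw [mul_comm, Complex.cpow_def_of_ne_zero (by exact_mod_cast (Real.exp_pos t).ne'),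
    ← Complex.ofReal_log (Real.exp_pos t).le, Real.log_exp, mul_comm (t : ℂ)]

theorem continuous_zetaSum_exp (r : ℝ → ℂ) (Y : ℝ) :
    Continuous fun t => zetaSum r Y (Real.exp t) := by
  simp only [zetaSum_exp]
  fun_prop

theorem integral_rieszProduct_mul_zetaSum (β : ℝ → ℝ) (S : Finset ℝ) (r : ℝ → ℂ) (Y a b : ℝ) :
    ∫ t in a..b, rieszProduct β S t * zetaSum r Y (Real.exp t) =
      ∑ γ ∈ zetaOrdinates Y, (r γ * rieszCoeff β a b S γ).re := by
  have h1 : ∀ t : ℝ, rieszProduct β S t * zetaSum r Y (Real.exp t) =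
      ∑ γ ∈ zetaOrdinates Y,
        (r γ * ((rieszProduct β S t : ℂ) * Complex.exp (Complex.I * γ * t))).re := by
    intro t
    rw [zetaSum_exp, Complex.re_sum, Finset.mul_sum]
    refine Finset.sum_congr rfl fun γ _ => ?_
    rw [mul_left_comm, Complex.re_ofReal_mul]
  simp only [h1]
  rw [intervalIntegral.integral_finsetSum
    fun γ _ => Continuous.intervalIntegrable (by fun_prop) _ _]
  refine Finset.sum_congr rfl fun γ _ => ?_
  rw [rieszCoeff, ← intervalIntegral.integral_const_mul]
  have hint : IntervalIntegrable (fun t : ℝ => r γ * ((rieszProduct β S t : ℂ) *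
      Complex.exp (Complex.I * γ * t))) MeasureTheory.volume a b :=
    Continuous.intervalIntegrable (by fun_prop) _ _
  exact Complex.reCLM.intervalIntegral_comp_comm hint

theorem sum_extend_mul {S D : Finset ℝ} (hSD : S ⊆ D) (e : ℝ → ℤ) :
    ∑ x ∈ D, ((if x ∈ S then e x else 0 : ℤ) : ℝ) * x = ∑ x ∈ S, (e x : ℝ) * x := by
  rw [← Finset.sum_subset hSD fun x _ hx => by simp [hx]]
  exact Finset.sum_congr rfl fun x hx => by simp [hx]

/-- The linear forms of height at most `2` in the ordinates up to `V` are at least `δ`. -/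
def OrdinatesSeparated (V δ : ℝ) : Prop :=
  ∀ ℓ : ℝ → ℤ, (∀ γ ∈ zetaOrdinates V, |ℓ γ| ≤ 2) → (∃ γ ∈ zetaOrdinates V, ℓ γ ≠ 0) →
    δ ≤ |∑ γ ∈ zetaOrdinates V, (ℓ γ : ℝ) * γ|

theorem OrdinatesSeparated.subset {V δ : ℝ} (h : OrdinatesSeparated V δ) {S : Finset ℝ}
    (hS : S ⊆ zetaOrdinates V) (e : ℝ → ℤ) (he : ∀ x ∈ S, |e x| ≤ 2) (h0 : ∃ x ∈ S, e x ≠ 0) :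
    δ ≤ |∑ x ∈ S, (e x : ℝ) * x| := by
  rw [← sum_extend_mul hS]
  refine h _ (fun x _ => ?_) ?_
  · split_ifs with hx
    · exact he x hx
    · simp
  · obtain ⟨x, hx, hxe⟩ := h0
    exact ⟨x, hS hx, by simpa [hx] using hxe⟩

theorem OrdinatesSeparated.add {V δ : ℝ} (h : OrdinatesSeparated V δ) {S : Finset ℝ}
    (hS : S ⊆ zetaOrdinates V) {γ : ℝ} (hγ : γ ∈ zetaOrdinates V) (hγS : γ ∉ S) (e : ℝ → ℤ)
    (he : ∀ x ∈ S, |e x| ≤ 1) : δ ≤ |γ + ∑ x ∈ S, (e x : ℝ) * x| := by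
  have := h.subset (S := insert γ S) (Finset.insert_subset hγ hS) (Function.update e γ 1)
    (fun x hx => (abs_update_le (by simp) he x hx).trans (by norm_num))
    ⟨γ, Finset.mem_insert_self _ _, by simp⟩
  rwa [sum_update_mul hγS, Int.cast_one, one_mul] at this

/-- Lower bound for the correlation of the Riesz product with `zetaSum`. -/
theorem le_integral_rieszProduct_mul_zetaSum (r : ℝ → ℂ) {T V Y a b δ : ℝ} (hδ : 0 < δ)
    (hsep : OrdinatesSeparated V δ) (hTV : T ≤ V) (hVY : V ≤ Y)
    (hsum : 2 * ∑ γ ∈ zetaOrdinates T, γ ≤ V) :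
    (b - a) / 2 * ∑ γ ∈ zetaOrdinates T, ‖r γ‖ -
        2 ^ (zetaOrdinates T).card * 2 * ((∑ γ ∈ zetaOrdinates V, ‖r γ‖) / δ +
          2 * ∑ γ ∈ zetaOrdinates Y, ‖r γ‖ / γ) ≤
      ∫ t in a..b, rieszProduct (fun γ => -(r γ).arg) (zetaOrdinates T) t *
        zetaSum r Y (Real.exp t) := by
  set S := zetaOrdinates T
  set β : ℝ → ℝ := fun γ => -(r γ).arg with hβ
  have hSV : S ⊆ zetaOrdinates V := zetaOrdinates_subset hTV
  have hSY : S ⊆ zetaOrdinates Y := zetaOrdinates_subset (hTV.trans hVY)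
  have hVY' : zetaOrdinates V ⊆ zetaOrdinates Y := zetaOrdinates_subset hVY
  rw [integral_rieszProduct_mul_zetaSum]
  have hind : ∀ (D : Finset ℝ) (f : ℝ → ℝ), D ⊆ zetaOrdinates Y →
      ∑ γ ∈ D, f γ = ∑ γ ∈ zetaOrdinates Y, if γ ∈ D then f γ else 0 := by
    intro D f hD
    rw [← Finset.sum_subset hD fun x _ hx => by simp [hx]]
    exact Finset.sum_congr rfl fun x hx => by simp [hx]
  rw [hind S _ hSY, hind _ _ hVY', Finset.mul_sum, Finset.sum_div, Finset.mul_sum,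
    ← Finset.sum_add_distrib, Finset.mul_sum, ← Finset.sum_sub_distrib]
  refine Finset.sum_le_sum fun γ hγ => ?_
  have hγ0 : 0 < γ := (mem_zetaOrdinates.1 hγ).1
  have hre : ∀ z : ℂ, -(‖r γ‖ * ‖z‖) ≤ (r γ * z).re := fun z => by
    rw [← norm_mul]; exact neg_le_of_abs_le (Complex.abs_re_le_norm _)
  by_cases hγV : γ ∈ zetaOrdinates V
  · have hpos : 0 ≤ (2 : ℝ) ^ S.card * 2 * (2 * (‖r γ‖ / γ)) := by positivity
    by_cases hγS : γ ∈ S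
    · have h1 := norm_rieszCoeff_self_sub_le β a b hδ S (hsep.subset hSV) hγS
      have h2 := hre (rieszCoeff β a b S γ - Complex.exp (Complex.I * β γ) / 2 * (b - a))
      have h3 : r γ * (Complex.exp (Complex.I * β γ) / 2 * (b - a)) =
          (((b - a) / 2 * ‖r γ‖ : ℝ) : ℂ) := by
        have h4 : Complex.exp ((r γ).arg * Complex.I) * Complex.exp (Complex.I * β γ) = 1 := by
          rw [← Complex.exp_add, hβ]
          simp [mul_comm]
        have h5 := Complex.norm_mul_exp_arg_mul_I (r γ)
        push_cast
        linear_combination (-(Complex.exp (Complex.I * β γ)) / 2 * (b - a)) * h5 +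
          ‖r γ‖ * (b - a) / 2 * h4
      rw [mul_sub (r γ) (rieszCoeff β a b S γ), h3, Complex.sub_re, Complex.ofReal_re] at h2
      have h6 := mul_le_mul_of_nonneg_left h1 (norm_nonneg (r γ))
      simp only [hγS, hγV, if_true]
      have h7 : ‖r γ‖ * (2 ^ S.card * (2 / δ)) = 2 ^ S.card * 2 * (‖r γ‖ / δ) := by ring
      linarith
    · have h1 := norm_rieszCoeff_le β a b hδ S γ (hsep.add hSV hγV hγS)
      have h2 := hre (rieszCoeff β a b S γ)
      have h6 := mul_le_mul_of_nonneg_left h1 (norm_nonneg (r γ))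
      simp only [hγS, hγV, if_true, if_false]
      have h7 : ‖r γ‖ * (2 ^ S.card * (2 / δ)) = 2 ^ S.card * 2 * (‖r γ‖ / δ) := by ring
      linarith
  · have hVγ : V < γ := by
      by_contra! hle
      exact hγV (mem_zetaOrdinates_of_le hγ hle)
    have hγS : γ ∉ S := fun h => hγV (hSV h)
    have h1 := norm_rieszCoeff_le β a b (half_pos hγ0) S γ fun e he => by
      have h4 : |∑ x ∈ S, (e x : ℝ) * x| ≤ ∑ x ∈ S, x := by
        refine (Finset.abs_sum_le_sum_abs _ _).trans (Finset.sum_le_sum fun x hx => ?_)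
        have hx0 : 0 < x := (mem_zetaOrdinates.1 hx).1
        rw [abs_mul, abs_of_pos hx0]
        have : |(e x : ℝ)| ≤ 1 := by exact_mod_cast he x hx
        exact mul_le_of_le_one_left hx0.le this
      refine le_trans ?_ (le_abs_self _)
      linarith [neg_le_of_abs_le h4]
    have h2 := hre (rieszCoeff β a b S γ)
    have h6 := mul_le_mul_of_nonneg_left h1 (norm_nonneg (r γ))
    simp only [hγS, hγV, if_false]
    have h7 : ‖r γ‖ * (2 ^ S.card * (2 / (γ / 2))) =
        2 ^ S.card * 2 * (0 / δ + 2 * (‖r γ‖ / γ)) := by field_simp; ring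
    linarith

/-- A large value of `zetaSum` on `[e^a, e^b]`, when the off-diagonal terms are small. -/
theorem exists_le_zetaSum (r : ℝ → ℂ) {T V Y a b δ : ℝ} (hδ : 0 < δ) (hab : a < b)
    (hsep : OrdinatesSeparated V δ) (hTV : T ≤ V) (hVY : V ≤ Y)
    (hsum : 2 * ∑ γ ∈ zetaOrdinates T, γ ≤ V) (hr : 1 ≤ ∑ γ ∈ zetaOrdinates T, ‖r γ‖)
    (herr : 2 ^ (zetaOrdinates T).card * 2 * ((∑ γ ∈ zetaOrdinates V, ‖r γ‖) / δ +
      2 * ∑ γ ∈ zetaOrdinates Y, ‖r γ‖ / γ) ≤ (b - a) / 4) :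
    ∃ t ∈ Set.Icc a b, (∑ γ ∈ zetaOrdinates T, ‖r γ‖) / 8 ≤ zetaSum r Y (Real.exp t) := by
  set S := zetaOrdinates T
  set R := ∑ γ ∈ S, ‖r γ‖
  set β : ℝ → ℝ := fun γ => -(r γ).arg
  have hSV : S ⊆ zetaOrdinates V := zetaOrdinates_subset hTV
  have hRV : R ≤ ∑ γ ∈ zetaOrdinates V, ‖r γ‖ :=
    Finset.sum_le_sum_of_subset_of_nonneg hSV fun _ _ _ => norm_nonneg _
  have hY0 : 0 ≤ ∑ γ ∈ zetaOrdinates Y, ‖r γ‖ / γ := Finset.sum_nonneg fun γ hγ =>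
    div_nonneg (norm_nonneg _) (mem_zetaOrdinates.1 hγ).1.le
  have hmain := le_integral_rieszProduct_mul_zetaSum r (a := a) (b := b) hδ hsep hTV hVY hsum
  have hmass : ∫ t in a..b, rieszProduct β S t ≤ 2 * (b - a) - (b - a) / 2 := by
    have h1 := norm_rieszCoeff_zero_sub_le β a b hδ S fun e he =>
      hsep.subset hSV e fun x hx => (he x hx).trans (by norm_num)
    have h2 : rieszCoeff β a b S 0 = ((∫ t in a..b, rieszProduct β S t : ℝ) : ℂ) := by
      simp [rieszCoeff, intervalIntegral.integral_ofReal]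
    rw [h2, ← Complex.ofReal_sub, ← Complex.ofReal_sub, Complex.norm_real, Real.norm_eq_abs] at h1
    have h3 : (2 : ℝ) ^ S.card * (2 / δ) ≤ (b - a) / 4 := by
      refine le_trans ?_ herr
      rw [mul_div_assoc']
      have : 1 / δ ≤ (∑ γ ∈ zetaOrdinates V, ‖r γ‖) / δ := by
        gcongr; exact hr.trans hRV
      calc (2 : ℝ) ^ S.card * 2 / δ = 2 ^ S.card * 2 * (1 / δ) := by ring
        _ ≤ _ := by gcongr; linarith
    linarith [le_of_abs_le h1]
  by_contra! hcon
  have hle : ∫ t in a..b, rieszProduct β S t * zetaSum r Y (Real.exp t) ≤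
      ∫ t in a..b, rieszProduct β S t * (R / 8) := by
    have hc := continuous_zetaSum_exp r Y
    refine intervalIntegral.integral_mono_on hab.le
      (Continuous.intervalIntegrable (by fun_prop) _ _)
      (Continuous.intervalIntegrable (by fun_prop) _ _) fun t ht =>
        mul_le_mul_of_nonneg_left (hcon t ht).le (rieszProduct_nonneg _ _ _)
  rw [intervalIntegral.integral_mul_const] at hle
  have h4 := mul_le_mul_of_nonneg_right hmass (by linarith : 0 ≤ R / 8)
  have h5 : 0 < (b - a) * R := mul_pos (sub_pos.2 hab) (by linarith)
  have h6 : (b - a) * 1 ≤ (b - a) * R := mul_le_mul_of_nonneg_left hr (sub_pos.2 hab).le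
  linarith

theorem zetaOrdinates_card_le (T : ℝ) : (zetaOrdinates T).card ≤ zetaZeroCount T := by
  classical
  set Z := (finite_nontrivialZetaZeros T).toFinset with hZ
  have hmem : ∀ ρ ∈ Z, ρ ∈ nontrivialZetaZeros := fun ρ hρ => by
    rw [hZ, Set.Finite.mem_toFinset] at hρ
    exact hρ.1
  have hsub : zetaOrdinates T ⊆ Z.image Complex.im := by
    intro γ hγ
    obtain ⟨h0, hT, ρ, hρ, rfl⟩ := mem_zetaOrdinates.1 hγ
    exact Finset.mem_image_of_mem _ (by
      rw [hZ, Set.Finite.mem_toFinset]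
      exact ⟨hρ, h0.le, hT⟩)
  refine (Finset.card_le_card hsub).trans (Finset.card_image_le.trans ?_)
  rw [zetaZeroCount, Finset.card_eq_sum_ones]
  refine Finset.sum_le_sum fun ρ hρ => ?_
  obtain ⟨hzero, -, h1⟩ := hmem ρ hρ
  have hne1 : ρ ≠ 1 := by rintro rfl; simp at h1
  have hdiff : DifferentiableOn ℂ riemannZeta {1}ᶜ := fun z hz =>
    (differentiableAt_riemannZeta hz).differentiableWithinAt
  have han : AnalyticOnNhd ℂ riemannZeta {1}ᶜ := hdiff.analyticOnNhd isOpen_compl_singleton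
  have hconn : IsPreconnected ({1}ᶜ : Set ℂ) :=
    (isConnected_compl_singleton_of_one_lt_rank (by simp) 1).isPreconnected
  have hne : analyticOrderAt riemannZeta ρ ≠ ⊤ := by
    intro htop
    have h2 := han.eqOn_zero_of_preconnected_of_eventuallyEq_zero hconn
      (show ρ ∈ ({1}ᶜ : Set ℂ) from hne1) (analyticOrderAt_eq_top.1 htop)
      (show (2 : ℂ) ∈ ({1}ᶜ : Set ℂ) by norm_num)
    exact riemannZeta_ne_zero_of_one_lt_re (by norm_num) h2
  rw [Nat.one_le_iff_ne_zero, ne_eq, ← Nat.cast_inj (R := ℕ∞), Nat.cast_analyticOrderNatAt hne]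
  exact fun h => (han ρ hne1).analyticOrderAt_ne_zero.2 hzero h

/-- Sums `∑ ‖r γ‖ / γ` stay bounded when `∑_{γ ≤ T} ‖r γ‖` is at most `√T`. -/
theorem exists_sum_norm_div_le (r : ℝ → ℂ)
    (h : ∀ᶠ T : ℝ in atTop, ∑ γ ∈ zetaOrdinates (T ^ 2), ‖r γ‖ ≤ T) :
    ∃ B : ℝ, ∀ Y : ℝ, ∑ γ ∈ zetaOrdinates Y, ‖r γ‖ / γ ≤ B := by
  have hnn : ∀ U : ℝ, ∀ γ ∈ zetaOrdinates U, 0 ≤ ‖r γ‖ / γ := fun U γ hγ =>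
    div_nonneg (norm_nonneg _) (mem_zetaOrdinates.1 hγ).1.le
  have hlim : Tendsto (fun m : ℕ => (2 : ℝ) ^ m) atTop atTop :=
    tendsto_pow_atTop_atTop_of_one_lt (by norm_num)
  obtain ⟨m₀, hm₀⟩ := eventually_atTop.1 (hlim.eventually h)
  set a : ℕ → ℝ := fun m => ∑ γ ∈ zetaOrdinates ((2 ^ m) ^ 2), ‖r γ‖ / γ with ha
  have hmono : ∀ {U W : ℝ}, U ≤ W →
      ∑ γ ∈ zetaOrdinates U, ‖r γ‖ / γ ≤ ∑ γ ∈ zetaOrdinates W, ‖r γ‖ / γ := fun {U W} hUW =>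
    Finset.sum_le_sum_of_subset_of_nonneg (zetaOrdinates_subset hUW) fun γ hγ _ => hnn W γ hγ
  have hstep : ∀ m, m₀ ≤ m → a (m + 1) ≤ a m + 2 / 2 ^ m := by
    intro m hm
    have hsub : zetaOrdinates (((2 : ℝ) ^ m) ^ 2) ⊆ zetaOrdinates ((2 ^ (m + 1)) ^ 2) :=
      zetaOrdinates_subset (by gcongr <;> simp)
    have hp : (0 : ℝ) < 2 ^ m := by positivity
    have hdiff : ∑ γ ∈ zetaOrdinates ((2 ^ (m + 1)) ^ 2) \ zetaOrdinates (((2 : ℝ) ^ m) ^ 2),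
        ‖r γ‖ / γ ≤ 2 / 2 ^ m := by
      calc _ ≤ ∑ γ ∈ zetaOrdinates ((2 ^ (m + 1)) ^ 2) \ zetaOrdinates (((2 : ℝ) ^ m) ^ 2),
            ‖r γ‖ / (2 ^ m) ^ 2 := by
            refine Finset.sum_le_sum fun γ hγ => ?_
            rw [Finset.mem_sdiff] at hγ
            have : ((2 : ℝ) ^ m) ^ 2 ≤ γ := by
              by_contra! hlt
              exact hγ.2 (mem_zetaOrdinates_of_le hγ.1 hlt.le)
            gcongr
        _ ≤ ∑ γ ∈ zetaOrdinates (((2 : ℝ) ^ (m + 1)) ^ 2), ‖r γ‖ / (2 ^ m) ^ 2 :=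
            Finset.sum_le_sum_of_subset_of_nonneg Finset.sdiff_subset fun _ _ _ => by positivity
        _ ≤ 2 ^ (m + 1) / (2 ^ m) ^ 2 := by
            rw [← Finset.sum_div]
            gcongr
            exact hm₀ (m + 1) (by omega)
        _ = 2 / 2 ^ m := by field_simp; ring
    have := Finset.sum_sdiff hsub (f := fun γ => ‖r γ‖ / γ)
    simp only [ha]
    linarith
  have hbound : ∀ k, a (m₀ + k) + 4 / 2 ^ (m₀ + k) ≤ a m₀ + 4 / 2 ^ m₀ := by
    intro k
    induction k with
    | zero => simp
    | succ k ih =>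
      have h1 := hstep (m₀ + k) (by omega)
      have h2 : (4 : ℝ) / 2 ^ (m₀ + (k + 1)) = 2 / 2 ^ (m₀ + k) := by
        rw [← add_assoc, pow_succ]; field_simp; ring
      have h3 : (4 : ℝ) / 2 ^ (m₀ + k) = 2 / 2 ^ (m₀ + k) + 2 / 2 ^ (m₀ + k) := by ring
      rw [← add_assoc] at h2 ⊢
      linarith
  refine ⟨a m₀ + 4 / 2 ^ m₀, fun Y => ?_⟩
  obtain ⟨k, hk⟩ := (hlim.eventually_ge_atTop (max Y 1)).exists
  have hk1 : (1 : ℝ) ≤ 2 ^ k := (le_max_right _ _).trans hk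
  have hpow : (2 : ℝ) ^ k ≤ 2 ^ (m₀ + k) := pow_le_pow_right₀ (by norm_num) (by omega)
  have hY : Y ≤ (2 ^ (m₀ + k)) ^ 2 := by
    have := (le_max_left Y 1).trans hk
    nlinarith
  have h4 : (0 : ℝ) < 4 / 2 ^ (m₀ + k) := by positivity
  have := hbound k
  have := hmono hY
  simp only [ha] at *
  linarith

theorem eventually_sum_norm_le_sqrt (r : ℝ → ℂ) {A : ℝ}
    (h1 : (fun T : ℝ => ∑ γ ∈ zetaOrdinates T, ‖r γ‖) =O[atTop] fun T => (Real.log T) ^ A) :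
    ∀ᶠ T : ℝ in atTop, ∑ γ ∈ zetaOrdinates (T ^ 2), ‖r γ‖ ≤ T := by
  have ho : (fun T : ℝ => ∑ γ ∈ zetaOrdinates T, ‖r γ‖) =o[atTop] fun T : ℝ => T ^ (1 / 2 : ℝ) :=
    h1.trans_isLittleO (isLittleO_log_rpow_rpow_atTop A (by norm_num))
  have hsq : Tendsto (fun T : ℝ => T ^ 2) atTop atTop := tendsto_pow_atTop (by norm_num)
  filter_upwards [hsq.eventually (ho.bound one_pos), eventually_ge_atTop 0] with T hT h0
  rw [one_mul, ← Real.sqrt_eq_rpow, Real.sqrt_sq h0, Real.norm_eq_abs, Real.norm_eq_abs,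
    abs_of_nonneg h0] at hT
  exact (le_abs_self _).trans hT

theorem EffectiveLI.exists_separated (hELI : EffectiveLI)
    (hN : ∀ᶠ T : ℝ in atTop, 2 ≤ zetaZeroCount T) :
    ∃ C : ℝ, 0 < C ∧ ∀ᶠ T : ℝ in atTop, OrdinatesSeparated T (C * Real.exp (-T ^ 2)) := by
  obtain ⟨C, hC, h⟩ := hELI 1 one_pos
  refine ⟨C, hC, ?_⟩
  filter_upwards [hN, eventually_ge_atTop 2] with T hT hT2 ℓ hℓ h0
  have := h T hT2 ℓ (fun γ hγ => (hℓ γ hγ).trans (by exact_mod_cast hT)) h0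
  rwa [one_add_one_eq_two, Real.rpow_two] at this

/-- Separation of linear forms bounds the number of ordinates. -/
theorem eventually_card_zetaOrdinates_le {C : ℝ} (hC : 0 < C)
    (h : ∀ᶠ T : ℝ in atTop, OrdinatesSeparated T (C * Real.exp (-T ^ 2))) :
    ∀ᶠ T : ℝ in atTop, ((zetaOrdinates T).card : ℝ) ≤ T ^ 3 := by
  filter_upwards [h, eventually_ge_atTop 9, eventually_ge_atTop (1 + 4 / C)] with T hT h9 hCT
  set n : ℝ := ((zetaOrdinates T).card : ℝ) with hn
  by_contra! hlt
  have hδ : 0 < C * Real.exp (-T ^ 2) := by positivity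
  have hpow := two_pow_card_le_of_dissociate (T := T) hδ
    (fun x hx => ⟨(mem_zetaOrdinates.1 hx).1.le, (mem_zetaOrdinates.1 hx).2.1⟩)
    (fun e he => hT.subset subset_rfl e fun x hx => (he x hx).trans (by norm_num))
  rw [← hn] at hpow
  have h2 : Real.exp (n / 2) ≤ 2 ^ (zetaOrdinates T).card := by
    have : Real.exp (n / 2) = Real.exp (1 / 2) ^ (zetaOrdinates T).card := by
      rw [← Real.exp_nat_mul]; congr 1; rw [← hn]; ring
    rw [this]
    gcongr
    rw [← Real.le_log_iff_exp_le (by norm_num)]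
    linarith [Real.log_two_gt_d9]
  have h3 : n ≤ 4 * Real.exp (n / 4) := by linarith [Real.add_one_le_exp (n / 4)]
  have h4 : n * T / (C * Real.exp (-T ^ 2)) = n * (T / C * Real.exp (T ^ 2)) := by
    rw [Real.exp_neg]; field_simp
  have hD : 0 ≤ T / C * Real.exp (T ^ 2) := by positivity
  have h5 : Real.exp (n / 2) = Real.exp (n / 4) * Real.exp (n / 4) := by
    rw [← Real.exp_add]; ring_nf
  have h6 : 1 ≤ Real.exp (n / 4) := Real.one_le_exp (by positivity)
  have h7 : Real.exp (n / 4) * Real.exp (n / 4) ≤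
      Real.exp (n / 4) * (4 * (T / C * Real.exp (T ^ 2)) + 1) := by
    rw [h4] at hpow
    have := mul_le_mul_of_nonneg_right h3 hD
    linarith
  have h8 := le_of_mul_le_mul_left h7 (by positivity)
  have h9 : 4 * (T / C * Real.exp (T ^ 2)) + 1 ≤ Real.exp T * Real.exp T * Real.exp (T ^ 2) := by
    have e1 : 1 ≤ Real.exp (T ^ 2) := Real.one_le_exp (by positivity)
    have e2 : T ≤ Real.exp T := by linarith [Real.add_one_le_exp T]
    have e3 : 4 * (T / C * Real.exp (T ^ 2)) + 1 ≤ T * (1 + 4 / C) * Real.exp (T ^ 2) := by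
      have : T * (1 + 4 / C) * Real.exp (T ^ 2) =
          4 * (T / C * Real.exp (T ^ 2)) + T * Real.exp (T ^ 2) := by ring
      rw [this]; nlinarith
    refine e3.trans ?_
    gcongr
    exact hCT.trans e2
  have h10 : Real.exp (n / 4) ≤ Real.exp (T + T + T ^ 2) := by
    rw [Real.exp_add, Real.exp_add]; exact h8.trans h9
  rw [Real.exp_le_exp] at h10
  nlinarith [mul_le_mul_of_nonneg_right (show (9 : ℝ) ≤ T by assumption) (sq_nonneg T)]

/-- The growth estimate for the off-diagonal terms. -/
theorem eventually_offDiagonal_le {C : ℝ} (hC : 0 < C) (B : ℝ) :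
    ∀ᶠ T : ℝ in atTop, Real.exp (T ^ 3) * 2 * (T ^ 5 / (C * Real.exp (-(T ^ 5) ^ 2)) + 2 * B) ≤
      (Real.exp (T ^ 11) - Real.log 2) / 4 := by
  filter_upwards [eventually_ge_atTop (16 + 4 / C + 2 * |B|)] with T hT
  have hC' : 0 < 4 / C := by positivity
  have hT16 : 16 ≤ T := by linarith [abs_nonneg B]
  have hT1 : 1 ≤ T := by linarith
  set E := Real.exp (T ^ 10) with hE
  have hTE : T ^ 10 ≤ E := by linarith [Real.add_one_le_exp (T ^ 10)]
  have hpow : ∀ k, k ≤ 10 → T ^ k ≤ E := fun k hk => (pow_le_pow_right₀ hT1 hk).trans hTE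
  have hTE1 : T ≤ E := by simpa using hpow 1 (by norm_num)
  have hE1 : 1 ≤ E := hT1.trans hTE1
  have e1 : Real.exp (T ^ 3) ≤ E := Real.exp_le_exp.2 (pow_le_pow_right₀ hT1 (by norm_num))
  have e2 : T ^ 5 / (C * Real.exp (-(T ^ 5) ^ 2)) ≤ E * E * E := by
    have : T ^ 5 / (C * Real.exp (-(T ^ 5) ^ 2)) = T ^ 5 * (1 / C) * E := by
      rw [hE, Real.exp_neg, ← pow_mul]; field_simp
    rw [this]
    have hC1 : 1 / C ≤ E := by
      have : 4 / C = 4 * (1 / C) := by ring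
      linarith [abs_nonneg B, hC']
    gcongr
    exact hpow 5 (by norm_num)
  have e3 : 2 * B ≤ E * E * E := by
    have : E ≤ E * E * E := by nlinarith
    linarith [le_abs_self B]
  have e4 : E ^ 6 ≤ Real.exp (T ^ 11) := by
    rw [hE, ← Real.exp_nat_mul, Real.exp_le_exp]
    have : 0 ≤ T ^ 10 := by positivity
    push_cast
    calc 6 * T ^ 10 ≤ T * T ^ 10 := by gcongr; linarith
      _ = T ^ 11 := by ring
  have e5 : Real.exp (T ^ 3) * 2 * (T ^ 5 / (C * Real.exp (-(T ^ 5) ^ 2)) + 2 * B) ≤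
      4 * E ^ 4 := by
    calc _ ≤ Real.exp (T ^ 3) * 2 * (E * E * E + E * E * E) := by gcongr
      _ ≤ E * 2 * (E * E * E + E * E * E) := by gcongr
      _ = 4 * E ^ 4 := by ring
  have e6 : 17 * E ^ 4 ≤ E ^ 6 + E ^ 4 := by
    have : 16 * E ^ 4 ≤ E ^ 2 * E ^ 4 := by gcongr; nlinarith
    nlinarith
  have e7 : 1 ≤ E ^ 4 := one_le_pow₀ hE1
  have hl2 := Real.log_two_lt_d9
  have e8 : 16 * E ^ 4 + 1 ≤ E ^ 6 := by
    have : 17 * E ^ 4 ≤ E ^ 2 * E ^ 4 := by gcongr; nlinarith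
    nlinarith
  linarith

/-- One-sided version of the main result. The Riesz product is a nonnegative kernel that isolates
the ordinates up to a power of `log log X`; the remaining ones contribute `O(‖r γ‖ / γ)` each, so
the size of `∑ ‖r γ‖` is the only information on `r` that is needed. -/
theorem exists_eventually_le_zetaSum (hELI : EffectiveLI) (r : ℝ → ℂ) {A : ℝ} (hA : 0 < A)
    (h1 : (fun T : ℝ => ∑ γ ∈ zetaOrdinates T, ‖r γ‖) =Θ[atTop] fun T => (Real.log T) ^ A) :
    ∃ c : ℝ, 0 < c ∧ ∀ᶠ X : ℝ in atTop, ∃ x ∈ Set.Icc 2 X,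
      c * (Real.log (Real.log (Real.log X))) ^ A ≤ zetaSum r (X ^ 2) x := by
  have hnn : ∀ T : ℝ, 0 ≤ ∑ γ ∈ zetaOrdinates T, ‖r γ‖ := fun T =>
    Finset.sum_nonneg fun _ _ => norm_nonneg _
  have hR : Tendsto (fun T : ℝ => ∑ γ ∈ zetaOrdinates T, ‖r γ‖) atTop atTop := by
    have hlog : Tendsto (fun T : ℝ => (Real.log T) ^ A) atTop atTop :=
      (tendsto_rpow_atTop hA).comp Real.tendsto_log_atTop
    have := h1.tendsto_norm_atTop_iff.2 (tendsto_norm_atTop_atTop.comp hlog)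
    simpa only [Function.comp_def, Real.norm_of_nonneg (hnn _)] using this
  have hN : ∀ᶠ T : ℝ in atTop, 2 ≤ zetaZeroCount T := by
    obtain ⟨T₁, hT₁⟩ := (hR.eventually_gt_atTop 0).exists
    filter_upwards [hR.eventually_gt_atTop (∑ γ ∈ zetaOrdinates T₁, ‖r γ‖),
      eventually_ge_atTop T₁] with T hT hTT₁
    refine le_trans ?_ (zetaOrdinates_card_le T)
    have hne : (zetaOrdinates T₁).Nonempty := by
      by_contra hempty
      simp [Finset.not_nonempty_iff_eq_empty.1 hempty] at hT₁
    have hss : zetaOrdinates T₁ ⊂ zetaOrdinates T :=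
      (zetaOrdinates_subset hTT₁).ssubset_of_ne fun heq => by rw [heq] at hT; exact hT.false
    have := Finset.card_lt_card hss
    have := hne.card_pos
    omega
  obtain ⟨C, hC, hsep⟩ := hELI.exists_separated hN
  have hsqrt := eventually_sum_norm_le_sqrt r h1.isBigO
  obtain ⟨B, hB⟩ := exists_sum_norm_div_le r hsqrt
  obtain ⟨c, hc, hcR⟩ := h1.isBigO_symm.exists_pos
  have hT5 : Tendsto (fun T : ℝ => T ^ 5) atTop atTop := tendsto_pow_atTop (by norm_num)
  have hlarge : ∀ᶠ T : ℝ in atTop, ∃ x ∈ Set.Icc 2 (Real.exp (Real.exp (T ^ 11))),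
      (8 * c)⁻¹ * (Real.log T) ^ A ≤ zetaSum r (Real.exp (Real.exp (T ^ 11)) ^ 2) x := by
    filter_upwards [hT5.eventually hsep, eventually_card_zetaOrdinates_le hC hsep,
      hT5.eventually hsqrt, hcR.bound,
      hR.eventually_ge_atTop 1, eventually_offDiagonal_le hC B,
      eventually_ge_atTop 2] with T hsepT hcard hV hlow hR1 hoff hT2
    have hT1 : 1 ≤ T := by linarith
    set b := Real.exp (T ^ 11)
    have hV0 : 1 ≤ T ^ 5 := one_le_pow₀ hT1
    have hb : T ^ 5 ≤ b := (pow_le_pow_right₀ hT1 (by norm_num : 5 ≤ 11)).trans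
      (by linarith [Real.add_one_le_exp (T ^ 11)])
    have hlb : Real.log 2 < b := by linarith [Real.log_two_lt_d9]
    have hbb : b ≤ Real.exp b ^ 2 := by
      have := Real.add_one_le_exp b
      nlinarith
    have hsum : 2 * ∑ γ ∈ zetaOrdinates T, γ ≤ T ^ 5 := by
      have : ∑ γ ∈ zetaOrdinates T, γ ≤ (zetaOrdinates T).card * T := by
        simpa using Finset.sum_le_card_nsmul (zetaOrdinates T) (fun x => x) T
          fun x hx => (mem_zetaOrdinates.1 hx).2.1
      calc 2 * ∑ γ ∈ zetaOrdinates T, γ ≤ T * (T ^ 3 * T) := by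
            have h3 : ∑ γ ∈ zetaOrdinates T, γ ≤ T ^ 3 * T := this.trans (by gcongr)
            exact mul_le_mul hT2 h3
              (Finset.sum_nonneg fun γ hγ => (mem_zetaOrdinates.1 hγ).1.le) (by linarith)
        _ = T ^ 5 := by ring
    have h2n : (2 : ℝ) ^ (zetaOrdinates T).card ≤ Real.exp (T ^ 3) := by
      calc (2 : ℝ) ^ (zetaOrdinates T).card ≤ Real.exp 1 ^ (zetaOrdinates T).card := by
            gcongr; linarith [Real.add_one_le_exp 1]
        _ = Real.exp ((zetaOrdinates T).card) := by rw [← Real.exp_nat_mul, mul_one]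
        _ ≤ _ := Real.exp_le_exp.2 hcard
    have hV' : ∑ γ ∈ zetaOrdinates (T ^ 5), ‖r γ‖ ≤ T ^ 5 :=
      (Finset.sum_le_sum_of_subset_of_nonneg (zetaOrdinates_subset (by nlinarith))
        fun _ _ _ => norm_nonneg _).trans hV
    have hY0 : 0 ≤ ∑ γ ∈ zetaOrdinates (Real.exp b ^ 2), ‖r γ‖ / γ :=
      Finset.sum_nonneg fun γ hγ => div_nonneg (norm_nonneg _) (mem_zetaOrdinates.1 hγ).1.le
    obtain ⟨t, ht, hle⟩ := exists_le_zetaSum r (δ := C * Real.exp (-(T ^ 5) ^ 2))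
      (Y := Real.exp b ^ 2) (by positivity) hlb hsepT (le_self_pow₀ hT1 (by norm_num))
      (hb.trans hbb) hsum hR1 (by
        refine le_trans ?_ hoff
        have := hB (Real.exp b ^ 2)
        have := div_nonneg (hnn (T ^ 5)) (show 0 ≤ C * Real.exp (-(T ^ 5) ^ 2) by positivity)
        gcongr)
    refine ⟨Real.exp t, ⟨?_, Real.exp_le_exp.2 ht.2⟩, le_trans ?_ hle⟩
    · rw [← Real.exp_log (show (0 : ℝ) < 2 by norm_num)]
      exact Real.exp_le_exp.2 ht.1
    · rw [Real.norm_of_nonneg (hnn T)] at hlow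
      have := (le_abs_self _).trans hlow
      rw [inv_mul_le_iff₀ (by positivity)]
      linarith
  refine ⟨(8 * c)⁻¹ * (1 / 11) ^ A, by positivity, ?_⟩
  have hX : Tendsto (fun X : ℝ => (Real.log (Real.log X)) ^ (1 / 11 : ℝ)) atTop atTop :=
    (tendsto_rpow_atTop (by norm_num)).comp (Real.tendsto_log_atTop.comp Real.tendsto_log_atTop)
  have hll := Real.tendsto_log_atTop.comp Real.tendsto_log_atTop
  filter_upwards [hX.eventually hlarge, hll.eventually_ge_atTop 1,
    Real.tendsto_log_atTop.eventually_gt_atTop 0, eventually_gt_atTop 0] with X hX1 hX2 hX3 hX4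
  simp only [Function.comp_apply] at hX2
  have hp : ((Real.log (Real.log X)) ^ (1 / 11 : ℝ)) ^ 11 = Real.log (Real.log X) := by
    rw [← Real.rpow_natCast, ← Real.rpow_mul (by linarith)]; norm_num
  rw [hp, Real.exp_log hX3, Real.exp_log hX4, Real.log_rpow (by linarith),
    Real.mul_rpow (by norm_num) (Real.log_nonneg hX2), ← mul_assoc] at hX1
  exact hX1

theorem zetaSum_neg (r : ℝ → ℂ) (Y x : ℝ) : zetaSum (fun γ => -r γ) Y x = -zetaSum r Y x := by
  simp [zetaSum]

theorem continuousOn_zetaSum (r : ℝ → ℂ) (Y X : ℝ) : ContinuousOn (zetaSum r Y) (Set.Icc 2 X) := by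
  have hlog : ContinuousOn Real.log (Set.Icc 2 X) :=
    Real.continuousOn_log.mono fun x hx => (lt_of_lt_of_le two_pos hx.1).ne'
  have h := (continuous_zetaSum_exp r Y).comp_continuousOn hlog
  refine h.congr fun x hx => ?_
  simp [Real.exp_log (show 0 < x by linarith [hx.1])]

theorem mainTheorem1 (hELI : EffectiveLI)
    -- only the values of `r` at the ordinates matter
    (r : ℝ → ℂ) (A θ : ℝ) (hA : 0 < A)
    (h1 : (fun T : ℝ => ∑ γ ∈ zetaOrdinates T, ‖r γ‖) =Θ[atTop] fun T => (Real.log T) ^ A)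
    (h2 : (fun T : ℝ => ∑ γ ∈ zetaOrdinates T, γ * ‖r γ‖) =o[atTop]
      fun T => T * (Real.log T) ^ A)
    (hθ1 : 1 ≤ θ) (hθ2 : θ < 3 - √3)
    (h3 : (fun T : ℝ => ∑ γ ∈ zetaOrdinates T, γ ^ 2 * ‖r γ‖ ^ 2) =O[atTop] fun T => T ^ θ) :
    ∃ C₁ C₂ : ℝ, 0 < C₁ ∧ 0 < C₂ ∧ ∀ᶠ X : ℝ in atTop,
      (∃ M : ℝ, IsGreatest (zetaSum r (X ^ 2) '' Set.Icc 2 X) M ∧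
        C₁ * (Real.log (Real.log (Real.log X))) ^ A ≤ M) ∧
      (∃ m : ℝ, IsLeast (zetaSum r (X ^ 2) '' Set.Icc 2 X) m ∧
        m ≤ -C₂ * (Real.log (Real.log (Real.log X))) ^ A) := by
  obtain ⟨C₁, hC₁, hmax⟩ := exists_eventually_le_zetaSum hELI r hA h1
  obtain ⟨C₂, hC₂, hmin⟩ := exists_eventually_le_zetaSum hELI (fun γ => -r γ) hA
    (by simpa only [norm_neg] using h1)
  refine ⟨C₁, C₂, hC₁, hC₂, ?_⟩
  filter_upwards [hmax, hmin, eventually_ge_atTop 2] with X ⟨x, hx, hxle⟩ ⟨y, hy, hyle⟩ hX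
  have hK : IsCompact (zetaSum r (X ^ 2) '' Set.Icc 2 X) :=
    isCompact_Icc.image_of_continuousOn (continuousOn_zetaSum r _ X)
  have hne : (zetaSum r (X ^ 2) '' Set.Icc 2 X).Nonempty := ⟨_, x, hx, rfl⟩
  obtain ⟨M, hM⟩ := hK.exists_isGreatest hne
  obtain ⟨m, hm⟩ := hK.exists_isLeast hne
  refine ⟨⟨M, hM, hxle.trans (hM.2 ⟨x, hx, rfl⟩)⟩, m, hm, ?_⟩
  have hmy := hm.2 ⟨y, hy, rfl⟩
  rw [zetaSum_neg] at hyle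
  linarith
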